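/- Let $G$ be a group and let $\mathcal F$ be a nonempty set of subgroups of $G$. A proper subgroup $K<G$ is called a complement of a subgroup $H\le G$ if $G=HK$ (no condition is imposed on $H\cap K$), and a common complement of $H_1,\dots,H_n\le G$ if it is a complement of the intersection $H_1\cap\dots\cap H_n$. The coset nerve of $\mathcal F$ is the simplicial complex whose vertices are the subsets $gH\subseteq G$ with $g\in G$ and $H\in\mathcal F$, and in which a nonempty finite set of vertices is a simplex if and only if these cosets have a common element in $G$. Suppose that for every $n\ge 1$ and all $H_1,\dots,H_n\in\mathcal F$ there is a common complement $K\in\mathcal F$ of $H_1,\dots,H_n$. Then the coset nerve of $\mathcal F$ is contractible, i.e. its geometric realization, with the weak topology, is a contractible topological space. -/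

import Mathlib

open scoped Pointwise

namespace CosetNerve

section Realization

/-- The underlying set of the geometric realization of a simplicial complex: the finitely supported
functions on the vertices (barycentric coordinates) that are nonnegative, sum to one, and whose
support is a simplex. -/
def Realization {V : Type*} (K : PreAbstractSimplicialComplex V) : Type _ :=
  {x : V →₀ ℝ // x.support ∈ K.faces ∧ (∀ v, 0 ≤ x v) ∧ (x.sum fun _ t => t) = 1}

/-- Extension by zero of the barycentric coordinates on a finite vertex set. -/
noncomputable def extend {V : Type*} (s : Finset V) (x : s → ℝ) : V →₀ ℝ :=
  Finsupp.embDomain (Function.Embedding.subtype (· ∈ s)) (Finsupp.equivFunOnFinite.symm x)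

theorem extend_apply_mem {V : Type*} (s : Finset V) (x : s → ℝ) (v : s) :
    extend s x v = x v :=
  Finsupp.embDomain_apply_self (Function.Embedding.subtype (· ∈ s)) _ v

theorem extend_apply_notMem {V : Type*} (s : Finset V) (x : s → ℝ) {v : V} (hv : v ∉ s) :
    extend s x v = 0 := by
  apply Finsupp.embDomain_of_notMem_range
  rintro ⟨w, rfl⟩
  exact hv w.2

theorem support_extend_subset {V : Type*} (s : Finset V) (x : s → ℝ) :
    (extend s x).support ⊆ s := by
  intro v hv
  by_contra h
  exact Finsupp.mem_support_iff.1 hv (extend_apply_notMem s x h)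

theorem extend_nonneg {V : Type*} (s : Finset V) (x : s → ℝ) (hx : ∀ v, 0 ≤ x v) (v : V) :
    0 ≤ extend s x v := by
  by_cases hv : v ∈ s
  · simpa using (extend_apply_mem s x ⟨v, hv⟩).symm ▸ hx ⟨v, hv⟩
  · exact (extend_apply_notMem s x hv).ge

theorem sum_extend {V : Type*} (s : Finset V) (x : s → ℝ) :
    ((extend s x).sum fun _ t => t) = ∑ v, x v := by
  rw [Finsupp.sum_of_support_subset _ (support_extend_subset s x) _ (fun _ _ => rfl),
    ← Finset.sum_coe_sort s]
  exact Finset.sum_congr rfl fun v _ => extend_apply_mem s x v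

/-- The characteristic map of a simplex `s` of `K`: the standard Euclidean simplex with vertex set
`s`, sent to the corresponding closed simplex of the realization. -/
noncomputable def simplexMap {V : Type*} (K : PreAbstractSimplicialComplex V) (s : Finset V)
    (hs : s ∈ K.faces) (x : stdSimplex ℝ s) : Realization K :=
  ⟨extend s x.1, by
    have h1 : ((extend s x.1).sum fun _ t => t) = 1 := (sum_extend s x.1).trans x.2.2
    refine ⟨(K.isRelLowerSet_faces hs).2 (support_extend_subset s x.1) ?_,
      extend_nonneg s x.1 x.2.1, h1⟩
    rw [Finset.nonempty_iff_ne_empty]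
    intro h
    simp [Finsupp.sum, h] at h1⟩

/-- The weak (CW) topology on the realization: the finest topology for which the characteristic
maps of all simplices are continuous, so that a set is open if and only if it meets every closed
simplex in a (Euclidean) open subset of that simplex. -/
noncomputable instance Realization.instTopologicalSpace {V : Type*} (K : PreAbstractSimplicialComplex V) :
    TopologicalSpace (Realization K) :=
  ⨆ s : K.faces, TopologicalSpace.coinduced (simplexMap K s.1 s.2) inferInstance

end Realization

/-- The nerve of an indexed family of subsets: its simplices are the nonempty finite sets of
indices for which the corresponding subsets have a common point. -/
def nerve {ι X : Type*} (A : ι → Set X) : PreAbstractSimplicialComplex ι where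
  faces := {s | s.Nonempty ∧ (⋂ i ∈ s, A i).Nonempty}
  isRelLowerSet_faces := fun {_} hs =>
    ⟨hs.1, fun _ hts ht => ⟨ht, hs.2.mono (Set.biInter_subset_biInter_left hts)⟩⟩

/-- The collection of all (left) cosets, as subsets of `G`, of the members of a set of
subgroups. -/
def cosets {G : Type*} [Group G] (F : Set (Subgroup G)) : Set (Set G) :=
  {C | ∃ H ∈ F, ∃ g : G, C = g • (H : Set G)}

/-- The coset nerve of a set of subgroups: the nerve of the (self-indexed) collection of their
cosets. -/
def cosetNerve {G : Type*} [Group G] (F : Set (Subgroup G)) :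
    PreAbstractSimplicialComplex (cosets F) :=
  nerve (fun C : cosets F => (C : Set G))

/-- `K` is a complement of `H`: a proper subgroup with `G = HK`. No condition is put on `H ∩ K`. -/
def IsComplementOf {G : Type*} [Group G] (K H : Subgroup G) : Prop :=
  K ≠ ⊤ ∧ (H : Set G) * (K : Set G) = Set.univ

/-- `K` is a common complement of a collection of subgroups: a complement of the intersection. -/
def IsCommonComplementOf {G : Type*} [Group G] (K : Subgroup G) (S : Set (Subgroup G)) : Prop :=
  IsComplementOf K (sInf S)

end CosetNerve

namespace CosetNerve

open Finset

/-! ### Maps out of and into a realization with the weak topology. -/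

section Topology

variable {V : Type*} {K : PreAbstractSimplicialComplex V}

/-! Every finite vertex set `S` of the coset nerve has a cone point: a common complement `K` of the
subgroups involved, since any simplex in `S` stays a simplex after adding the coset `K`
(`exists_cone_point_cosetNerve`). This alone forces contractibility of any complex. Choose `c σ` by
recursion as a cone point for `σ` together with all `c τ`, `τ ⊂ σ`; then a simplex `a` and the `c
σ`, for `σ` in a chain above `a`, span a simplex (`exists_isConeFamily`). At time `t` the part of
each coordinate above level `2t` is kept, and mass is put on `c σ` for superlevel sets `σ` of `x`,
which form such a chain. At time `1` only `c ∅` is left. -/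

theorem continuous_simplexMap (s : Finset V) (hs : s ∈ K.faces) :
    Continuous (simplexMap K s hs) := by
  rw [continuous_iff_coinduced_le]
  exact le_iSup (fun s : K.faces => TopologicalSpace.coinduced (simplexMap K s.1 s.2) inferInstance)
    ⟨s, hs⟩

theorem Realization.continuous_iff {Y : Type*} [TopologicalSpace Y] {f : Realization K → Y} :
    Continuous f ↔ ∀ (s : Finset V) (hs : s ∈ K.faces), Continuous (f ∘ simplexMap K s hs) := by
  refine ⟨fun h s hs => h.comp (continuous_simplexMap s hs), fun h => ?_⟩
  rw [continuous_iff_coinduced_le]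
  change TopologicalSpace.coinduced f (⨆ s : K.faces, _) ≤ _
  rw [coinduced_iSup]
  refine iSup_le fun s => ?_
  rw [coinduced_compose]
  exact continuous_iff_coinduced_le.1 (h s.1 s.2)

theorem Realization.sum_eq_one (x : Realization K) {s : Finset V} (h : x.1.support ⊆ s) :
    ∑ v ∈ s, x.1 v = 1 :=
  (Finsupp.sum_of_support_subset _ h _ (fun _ _ => rfl)).symm.trans x.2.2.2

/-- The barycentric coordinates, on a finite vertex set, of a point supported there. -/
def Realization.coords (x : Realization K) (s : Finset V) (h : x.1.support ⊆ s) :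
    stdSimplex ℝ s :=
  ⟨fun v => x.1 v, fun v => x.2.2.1 v, by
    rw [Finset.sum_coe_sort s (fun v => x.1 v)]; exact x.sum_eq_one h⟩

theorem Realization.simplexMap_coords (x : Realization K) (s : Finset V) (hs : s ∈ K.faces)
    (h : x.1.support ⊆ s) : simplexMap K s hs (x.coords s h) = x := by
  apply Subtype.ext
  ext v
  by_cases hv : v ∈ s
  · exact extend_apply_mem s _ ⟨v, hv⟩
  · exact (extend_apply_notMem s _ hv).trans
      (Finsupp.notMem_support_iff.1 fun h' => hv (h h')).symm

/-- A map into the realization whose values are all supported on one finite set of vertices is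
continuous as soon as its barycentric coordinates are. -/
theorem Realization.continuous_of_support_subset {X : Type*} [TopologicalSpace X]
    (q : X → Realization K) (T : Finset V) (hT : ∀ x, (q x).1.support ⊆ T)
    (hq : ∀ v, Continuous fun x => (q x).1 v) : Continuous q := by
  classical
  let A : {ρ : Finset V // ρ ∈ T.powerset ∧ ρ ∈ K.faces} → Set X :=
    fun ρ => {x | (q x).1.support ⊆ ρ.1}
  have : Finite {ρ : Finset V // ρ ∈ T.powerset ∧ ρ ∈ K.faces} :=
    Finite.Set.subset (T.powerset : Set (Finset V)) fun _ h => h.1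
  -- The sets `A ρ` form a finite closed cover, and on each of them `q` factors through the
  -- characteristic map of `ρ`.
  refine (locallyFinite_of_finite A).continuous ?_ ?_ ?_
  · refine Set.eq_univ_of_forall fun x => Set.mem_iUnion.2
      ⟨⟨(q x).1.support, Finset.mem_powerset.2 (hT x), (q x).2.1⟩, ?_⟩
    exact Finset.Subset.refl _
  · intro ρ
    have : A ρ = ⋂ v ∈ {v | v ∉ ρ.1}, {x | (q x).1 v = 0} := by
      ext x
      simp only [A, Set.mem_ofPred_eq, Set.mem_iInter]
      refine ⟨fun h v hv => Finsupp.notMem_support_iff.1 fun h' => hv (h h'), fun h v hv => ?_⟩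
      by_contra h'
      exact Finsupp.mem_support_iff.1 hv (h v h')
    rw [this]
    exact isClosed_biInter fun v _ => isClosed_eq (hq v) continuous_const
  · intro ρ
    rw [continuousOn_iff_continuous_domRestrict]
    have : (A ρ).domRestrict q =
        simplexMap K ρ.1 ρ.2.2 ∘ fun x : A ρ => (q x).coords ρ.1 x.2 := by
      funext x
      exact ((q x).simplexMap_coords ρ.1 ρ.2.2 x.2).symm
    rw [this]
    refine (continuous_simplexMap _ _).comp (Continuous.subtype_mk ?_ _)
    exact continuous_pi fun v => (hq v).comp continuous_subtype_val

/-- The weak topology is compatible with products with the unit interval. -/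
theorem Realization.continuous_prod_unitInterval {Y : Type*} [TopologicalSpace Y]
    (h : Realization K × unitInterval → Y)
    (hh : ∀ (s : Finset V) (hs : s ∈ K.faces),
      Continuous fun p : stdSimplex ℝ s × unitInterval => h (simplexMap K s hs p.1, p.2)) :
    Continuous h := by
  have hx : ∀ x : Realization K, Continuous fun t : unitInterval => h (x, t) := by
    intro x
    have := (hh _ x.2.1).comp
      (Continuous.prodMk_right (X := stdSimplex ℝ x.1.support) (x.coords _ (Finset.Subset.refl _)))
    simpa only [Function.comp_def, x.simplexMap_coords] using this
  -- Currying reduces continuity to single simplices; uncurrying is allowed because the interval is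
  -- locally compact.
  let F : Realization K → C(unitInterval, Y) := fun x => ⟨fun t => h (x, t), hx x⟩
  have hF : Continuous F := by
    rw [Realization.continuous_iff]
    intro s hs
    exact (ContinuousMap.curry ⟨_, hh s hs⟩).continuous
  exact ContinuousMap.continuous_uncurry_of_continuous ⟨F, hF⟩

end Topology

/-! ### The contraction built from cone points. -/

section Contraction

variable {V : Type*}

open Classical in
/-- The largest coordinate of `x` outside of `σ` (zero if there is none). -/
noncomputable def outerSup (σ : Finset V) (x : V →₀ ℝ) : ℝ :=
  (((x.support \ σ).sup fun v => (x v).toNNReal : NNReal) : ℝ)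

theorem outerSup_nonneg (σ : Finset V) (x : V →₀ ℝ) : 0 ≤ outerSup σ x := NNReal.coe_nonneg _

theorem le_outerSup {σ : Finset V} (x : V →₀ ℝ) {v : V} (hv : v ∉ σ) :
    x v ≤ outerSup σ x := by
  classical
  by_cases h : x v = 0
  · exact h ▸ outerSup_nonneg σ x
  · refine (Real.le_coe_toNNReal _).trans (NNReal.coe_le_coe.2 ?_)
    exact Finset.le_sup (f := fun v => (x v).toNNReal)
      (Finset.mem_sdiff.2 ⟨Finsupp.mem_support_iff.2 h, hv⟩)

/-- Index set independent of `x`, as needed for continuity on a closed simplex. -/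
theorem outerSup_eq [DecidableEq V] (σ : Finset V) (x : V →₀ ℝ) {τ : Finset V}
    (h : x.support ⊆ τ) :
    outerSup σ x = (((τ \ σ).sup fun v => (x v).toNNReal : NNReal) : ℝ) := by
  apply le_antisymm
  · refine NNReal.coe_le_coe.2 (Finset.sup_mono fun v hv => ?_)
    simp only [Finset.mem_sdiff] at hv ⊢
    exact ⟨h hv.1, hv.2⟩
  · rw [← NNReal.coe_mk _ (outerSup_nonneg σ x), NNReal.coe_le_coe]
    refine Finset.sup_le fun v hv => ?_
    rw [← NNReal.coe_le_coe]
    exact (Real.coe_toNNReal' _).trans_le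
      (max_le (le_outerSup x (Finset.mem_sdiff.1 hv).2) (outerSup_nonneg σ x))

theorem outerSup_support (x : V →₀ ℝ) : outerSup x.support x = 0 := by
  simp [outerSup]

theorem outerSup_le {σ : Finset V} {x : V →₀ ℝ} {a : ℝ} (ha : 0 ≤ a) (h : ∀ v, x v ≤ a) :
    outerSup σ x ≤ a := by
  rw [← NNReal.coe_mk a ha]
  exact NNReal.coe_le_coe.2 (Finset.sup_le fun v _ => Real.toNNReal_le_iff_le_coe.2 (h v : x v ≤ ((⟨a, ha⟩ : NNReal) : ℝ)))

/-- The mass that the contraction puts on the cone point of `σ` at time `t`. -/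
noncomputable def weight (σ : Finset V) (x : V →₀ ℝ) (t : unitInterval) : ℝ := by
  classical
  -- The first factor removes all nonempty `σ` at time `1`. With `2t` in place of `t`, the weight of
  -- `∅` at time `1` is at least `1` when coordinates are at most `1`.
  exact (if σ = ∅ then 1 else 1 - t.1) *
    (max (2 * t.1 - outerSup σ x) 0 * ∏ v ∈ σ, max (x v - outerSup σ x) 0)

theorem weight_nonneg (σ : Finset V) (x : V →₀ ℝ) (t : unitInterval) : 0 ≤ weight σ x t := by
  have := t.2.2
  refine mul_nonneg ?_ (mul_nonneg (le_max_right _ _)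
    (Finset.prod_nonneg fun _ _ => le_max_right _ _))
  split_ifs <;> linarith

/-- With `le_outerSup`, this says that only strict superlevel sets of `x` carry weight. -/
theorem outerSup_lt_of_weight_ne_zero {σ : Finset V} {x : V →₀ ℝ} {t : unitInterval}
    (h : weight σ x t ≠ 0) : outerSup σ x < 2 * t.1 ∧ ∀ v ∈ σ, outerSup σ x < x v := by
  have h1 := right_ne_zero_of_mul h
  refine ⟨?_, fun v hv => ?_⟩
  · by_contra h2
    exact left_ne_zero_of_mul h1 (max_eq_right (by linarith))
  · by_contra h2
    exact Finset.prod_ne_zero_iff.1 (right_ne_zero_of_mul h1) v hv (max_eq_right (by linarith))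

theorem weight_eq_zero_of_not_subset {σ : Finset V} {x : V →₀ ℝ} {t : unitInterval}
    (h : ¬ σ ⊆ x.support) : weight σ x t = 0 := by
  by_contra h'
  refine h fun v hv => Finsupp.mem_support_iff.2 ?_
  exact ((outerSup_nonneg σ x).trans_lt ((outerSup_lt_of_weight_ne_zero h').2 v hv)).ne'

theorem weight_zero (σ : Finset V) (x : V →₀ ℝ) : weight σ x 0 = 0 := by
  by_contra h
  have := (outerSup_lt_of_weight_ne_zero h).1
  have := outerSup_nonneg σ x
  simp at *
  linarith

theorem weight_one {σ : Finset V} (hσ : σ ≠ ∅) (x : V →₀ ℝ) : weight σ x 1 = 0 := by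
  simp [weight, hσ]

/-- Superlevel sets are nested: `v ∈ σ \ τ` and `w ∈ τ \ σ` would give both `x w < x v` and `x v < x
w`. -/
theorem subset_or_subset_of_weight_ne_zero {σ τ : Finset V} {x : V →₀ ℝ} {t : unitInterval}
    (hσ : weight σ x t ≠ 0) (hτ : weight τ x t ≠ 0) : σ ⊆ τ ∨ τ ⊆ σ := by
  by_contra! h
  obtain ⟨v, hv, hv'⟩ := Finset.not_subset.1 h.1
  obtain ⟨w, hw, hw'⟩ := Finset.not_subset.1 h.2
  have h1 := (outerSup_lt_of_weight_ne_zero hσ).2 v hv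
  have h2 := (outerSup_lt_of_weight_ne_zero hτ).2 w hw
  have h3 := le_outerSup x hv'
  have h4 := le_outerSup x hw'
  linarith

/-- The contraction before normalization: the coordinates above level `2t` survive, and the rest of
the mass is moved to the cone points of the superlevel sets. -/
noncomputable def massFlow (c : Finset V → V) (x : V →₀ ℝ) (t : unitInterval) : V →₀ ℝ :=
  x.mapRange (fun r => max (r - 2 * t.1) 0) (max_eq_right (by linarith [t.2.1])) +
    ∑ σ ∈ x.support.powerset, Finsupp.single (c σ) (weight σ x t)

theorem massFlow_apply [DecidableEq V] (c : Finset V → V) (x : V →₀ ℝ) (t : unitInterval)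
    {τ : Finset V} (h : x.support ⊆ τ) (u : V) :
    massFlow c x t u = max (x u - 2 * t.1) 0 +
      ∑ σ ∈ τ.powerset, if c σ = u then weight σ x t else 0 := by
  have : ∀ σ, (Finsupp.single (c σ) (weight σ x t)) u = if c σ = u then weight σ x t else 0 :=
    fun σ => Finsupp.single_apply
  simp only [massFlow, Finsupp.add_apply, Finsupp.mapRange_apply, Finsupp.finsetSum_apply, this]
  congr 1
  refine Finset.sum_subset (Finset.powerset_mono.2 h) fun σ _ hσ => ?_
  rw [weight_eq_zero_of_not_subset (by simpa using hσ), ite_self]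

theorem massFlow_nonneg (c : Finset V → V) (x : V →₀ ℝ) (t : unitInterval) (u : V) :
    0 ≤ massFlow c x t u := by
  classical
  rw [massFlow_apply c x t (Finset.Subset.refl _)]
  refine add_nonneg (le_max_right _ _) (Finset.sum_nonneg fun σ _ => ?_)
  split_ifs
  exacts [weight_nonneg _ _ _, le_rfl]

theorem weight_le_massFlow (c : Finset V → V) (x : V →₀ ℝ) (t : unitInterval) {σ : Finset V}
    (hσ : σ ⊆ x.support) : weight σ x t ≤ massFlow c x t (c σ) := by
  classical
  rw [massFlow_apply c x t (Finset.Subset.refl _)]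
  refine le_add_of_nonneg_of_le (le_max_right _ _) ?_
  refine le_trans (by simp) (Finset.single_le_sum (f := fun ρ => if c ρ = c σ then weight ρ x t
    else 0) (fun ρ _ => ?_) (Finset.mem_powerset.2 hσ))
  split_ifs
  exacts [weight_nonneg _ _ _, le_rfl]

theorem massFlow_zero (c : Finset V → V) (x : V →₀ ℝ) (hx : ∀ v, 0 ≤ x v) :
    massFlow c x 0 = x := by
  classical
  ext u
  rw [massFlow_apply c x 0 (Finset.Subset.refl _)]
  simp [weight_zero, hx u]

theorem massFlow_one (c : Finset V → V) (x : V →₀ ℝ) (hx : ∀ v, x v ≤ 1) :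
    massFlow c x 1 = Finsupp.single (c ∅) (weight ∅ x 1) := by
  classical
  ext u
  rw [massFlow_apply c x 1 (Finset.Subset.refl _), Finset.sum_eq_single ∅, Finsupp.single_apply,
    max_eq_right, zero_add]
  · have := hx u
    simp
    linarith
  · intro σ _ hσ
    rw [weight_one hσ, ite_self]
  · simp

/-- The mass survives as `x` itself at time `0`, on `c ∅` at time `1`, and in between on the cone
point of the full support, whose outer supremum is `0`. -/
theorem massFlow_ne_zero (c : Finset V → V) (x : V →₀ ℝ) (t : unitInterval) (h0 : ∀ v, 0 ≤ x v)
    (h1 : ∀ v, x v ≤ 1) (hx : x ≠ 0) : massFlow c x t ≠ 0 := by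
  classical
  intro h
  rcases t.2.1.eq_or_lt with ht | ht
  · obtain rfl : t = 0 := Subtype.ext ht.symm
    exact hx (massFlow_zero c x h0 ▸ h)
  rcases t.2.2.eq_or_lt with ht' | ht'
  · have := weight_le_massFlow c x t (Finset.empty_subset _)
    rw [h, weight, if_pos rfl, ht'] at this
    have h2 := outerSup_le (σ := ∅) zero_le_one h1
    have h3 := le_max_left (2 * 1 - outerSup ∅ x) 0
    simp only [Finset.prod_empty, Finsupp.coe_zero, Pi.zero_apply] at this
    linarith
  · have := weight_le_massFlow c x t (Finset.Subset.refl _)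
    rw [h, weight, if_neg (by simpa using hx), outerSup_support] at this
    refine this.not_gt (mul_pos (by linarith) (mul_pos (lt_max_of_lt_left (by simpa using ht))
      (Finset.prod_pos fun v hv => lt_max_of_lt_left ?_)))
    simpa using (h0 v).lt_of_ne' (Finsupp.mem_support_iff.1 hv)

/-- A family of vertices, one for each finite set of vertices, with which the simplices below
superlevel sets can successively be coned off. -/
def IsConeFamily (K : PreAbstractSimplicialComplex V) (c : Finset V → V) : Prop :=
  ∀ (a : Finset V) (C : Finset (Finset V)), (a = ∅ ∨ a ∈ K.faces) → (a = ∅ → C.Nonempty) →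
    (∀ σ ∈ C, a ⊆ σ) → (∀ σ ∈ C, ∀ τ ∈ C, σ ⊆ τ ∨ τ ⊆ σ) →
    ∃ ρ ∈ K.faces, a ⊆ ρ ∧ ∀ σ ∈ C, c σ ∈ ρ

theorem exists_isConeFamily (K : PreAbstractSimplicialComplex V)
    (hK : ∀ S : Finset V, ∃ v, ∀ ρ ⊆ S, ρ = ∅ ∨ ρ ∈ K.faces →
      ∃ ρ' ∈ K.faces, ρ ⊆ ρ' ∧ v ∈ ρ') : ∃ c, IsConeFamily K c := by
  classical
  choose p hp using hK
  -- `c σ` cones off `σ` along with all cone points chosen for its proper subsets.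
  let step : ∀ σ : Finset V, (∀ τ ⊂ σ, V) → V := fun σ ih =>
    p (σ ∪ σ.ssubsets.attach.image fun τ => ih τ.1 (Finset.mem_ssubsets.1 τ.2))
  let c : Finset V → V := Finset.strongInduction step
  have hc : ∀ σ, c σ = p (σ ∪ σ.ssubsets.image c) := by
    intro σ
    refine (Finset.strongInduction_eq step σ).trans (congrArg (fun A => p (σ ∪ A)) ?_)
    ext u
    simp [c]
  have key : ∀ (n : ℕ) (a : Finset V) (C : Finset (Finset V)), C.card = n →
      (a = ∅ ∨ a ∈ K.faces) → (∀ σ ∈ C, a ⊆ σ) → (∀ σ ∈ C, ∀ τ ∈ C, σ ⊆ τ ∨ τ ⊆ σ) →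
      a ∪ C.image c = ∅ ∨ a ∪ C.image c ∈ K.faces := by
    intro n
    induction n with
    | zero =>
      intro a C hC ha _ _
      simpa [Finset.card_eq_zero.1 hC] using ha
    | succ n ih =>
      intro a C hC ha haC hch
      have hne : C.Nonempty := Finset.card_pos.1 (by omega)
      -- Remove the largest member `m` of the chain: `a` and the remaining cone points lie in the
      -- set that `c m` cones off.
      obtain ⟨m, hm, hmax⟩ := C.exists_max_image Finset.card hne
      have hle : ∀ σ ∈ C, σ ⊆ m := by
        intro σ hσ
        rcases hch σ hσ m hm with h | h
        · exact h
        · exact (Finset.eq_of_subset_of_card_le h (hmax σ hσ)).ge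
      have h1 := ih a (C.erase m) (by rw [Finset.card_erase_of_mem hm]; omega) ha
        (fun σ hσ => haC σ (Finset.mem_of_mem_erase hσ))
        (fun σ hσ τ hτ => hch σ (Finset.mem_of_mem_erase hσ) τ (Finset.mem_of_mem_erase hτ))
      obtain ⟨ρ', hρ', hsub, hv⟩ := hp (m ∪ m.ssubsets.image c) (a ∪ (C.erase m).image c) (by
        refine Finset.union_subset_union (haC m hm) (Finset.image_subset_image fun σ hσ => ?_)
        rw [Finset.mem_ssubsets]
        exact (hle σ (Finset.mem_of_mem_erase hσ)).ssubset_of_ne (Finset.ne_of_mem_erase hσ)) h1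
      right
      refine (K.isRelLowerSet_faces hρ').2 (show a ∪ C.image c ⊆ ρ' from ?_)
        (Finset.Nonempty.inr (hne.image c))
      rw [← hc] at hv
      refine Finset.union_subset (Finset.subset_union_left.trans hsub) fun u hu => ?_
      obtain ⟨σ, hσ, rfl⟩ := Finset.mem_image.1 hu
      by_cases h : σ = m
      · exact h ▸ hv
      · exact hsub (Finset.mem_union_right _
          (Finset.mem_image_of_mem c (Finset.mem_erase.2 ⟨h, hσ⟩)))
  refine ⟨c, fun a C ha hne haC hch => ⟨a ∪ C.image c, ?_, Finset.subset_union_left,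
    fun σ hσ => Finset.mem_union_right _ (Finset.mem_image_of_mem c hσ)⟩⟩
  refine (key _ a C rfl ha haC hch).resolve_left fun h => ?_
  obtain ⟨h1, h2⟩ := Finset.union_eq_empty.1 h
  exact (hne h1).ne_empty (Finset.image_eq_empty.1 h2)

variable {K : PreAbstractSimplicialComplex V}

theorem Realization.le_one (x : Realization K) (v : V) : x.1 v ≤ 1 := by
  classical
  exact (Finset.single_le_sum (f := fun v => x.1 v) (fun u _ => x.2.2.1 u)
    (Finset.mem_insert_self _ _)).trans_eq (x.sum_eq_one (Finset.subset_insert v x.1.support))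

theorem Realization.ne_zero (x : Realization K) : x.1 ≠ 0 := by
  intro h
  simpa [h] using x.2.2.2

/-- The support lies in `a ∪ c(C)`, where `a` is the set of coordinates above `2t` and `C` the chain
of sets with nonzero weight. Each `σ ∈ C` contains `a`, since coordinates outside `σ` are below
`2t`. -/
theorem support_massFlow_mem {c : Finset V → V} (hc : IsConeFamily K c) (x : Realization K)
    (t : unitInterval) : (massFlow c x.1 t).support ∈ K.faces := by
  classical
  have hne : (massFlow c x.1 t).support.Nonempty :=
    Finsupp.support_nonempty_iff.2 (massFlow_ne_zero c x.1 t x.2.2.1 x.le_one x.ne_zero)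
  set a := x.1.support.filter fun v => 2 * t.1 < x.1 v with ha
  set C := x.1.support.powerset.filter fun σ => weight σ x.1 t ≠ 0 with hC
  have hsupp : ∀ u ∈ (massFlow c x.1 t).support, u ∈ a ∨ ∃ σ ∈ C, c σ = u := by
    intro u hu
    by_contra! h
    refine Finsupp.mem_support_iff.1 hu ?_
    rw [massFlow_apply c x.1 t (Finset.Subset.refl _), Finset.sum_eq_zero, add_zero]
    · refine max_eq_right (sub_nonpos.2 (not_lt.1 fun h' => h.1 (Finset.mem_filter.2 ⟨?_, h'⟩)))
      have := t.2.1
      exact Finsupp.mem_support_iff.2 (by linarith : 0 < x.1 u).ne'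
    · intro σ hσ
      split_ifs with hu
      · by_contra h'
        exact h.2 σ (Finset.mem_filter.2 ⟨hσ, h'⟩) hu
      · rfl
  have haK : a = ∅ ∨ a ∈ K.faces := by
    rcases a.eq_empty_or_nonempty with h | h
    · exact Or.inl h
    · exact Or.inr ((K.isRelLowerSet_faces x.2.1).2 (Finset.filter_subset _ _) h)
  have hCne : a = ∅ → C.Nonempty := by
    intro h
    obtain ⟨u, hu⟩ := hne
    rcases hsupp u hu with h' | ⟨σ, hσ, -⟩
    · simp [h] at h'
    · exact ⟨σ, hσ⟩
  have haC : ∀ σ ∈ C, a ⊆ σ := by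
    intro σ hσ v hv
    by_contra h
    have h1 := (outerSup_lt_of_weight_ne_zero (Finset.mem_filter.1 hσ).2).1
    have h2 := le_outerSup x.1 h
    have h3 := (Finset.mem_filter.1 hv).2
    linarith
  obtain ⟨ρ, hρ, haρ, hCρ⟩ := hc a C haK hCne haC fun σ hσ τ hτ =>
    subset_or_subset_of_weight_ne_zero (Finset.mem_filter.1 hσ).2 (Finset.mem_filter.1 hτ).2
  refine (K.isRelLowerSet_faces hρ).2 (show _ ⊆ ρ from fun u hu => ?_) hne
  rcases hsupp u hu with h | ⟨σ, hσ, rfl⟩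
  exacts [haρ h, hCρ σ hσ]

theorem sum_massFlow_pos (c : Finset V → V) (x : Realization K) (t : unitInterval) :
    0 < (massFlow c x.1 t).sum fun _ r => r := by
  obtain ⟨u, hu⟩ := Finsupp.support_nonempty_iff.2
    (massFlow_ne_zero c x.1 t x.2.2.1 x.le_one x.ne_zero)
  exact Finset.sum_pos' (fun v _ => massFlow_nonneg c x.1 t v)
    ⟨u, hu, (massFlow_nonneg c x.1 t u).lt_of_ne' (Finsupp.mem_support_iff.1 hu)⟩

/-- The contraction of the realization defined by a family of cone points. -/
noncomputable def contraction {c : Finset V → V} (hc : IsConeFamily K c)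
    (p : Realization K × unitInterval) : Realization K :=
  ⟨((massFlow c p.1.1 p.2).sum fun _ r => r)⁻¹ • massFlow c p.1.1 p.2, by
    have hpos := sum_massFlow_pos c p.1 p.2
    refine ⟨?_, fun v => ?_, ?_⟩
    · rw [Finsupp.support_smul_eq (inv_ne_zero hpos.ne')]
      exact support_massFlow_mem hc p.1 p.2
    · exact mul_nonneg (inv_nonneg.2 hpos.le) (massFlow_nonneg c _ _ v)
    · rw [Finsupp.sum_smul_index' (fun _ => rfl)]
      simp only [smul_eq_mul]
      rw [← Finsupp.mul_sum]
      exact inv_mul_cancel₀ hpos.ne'⟩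

theorem contraction_zero {c : Finset V → V} (hc : IsConeFamily K c) (x : Realization K) :
    contraction hc (x, 0) = x := by
  apply Subtype.ext
  simp only [contraction, massFlow_zero c x.1 x.2.2.1, x.2.2.2, inv_one, one_smul]

theorem contraction_one {c : Finset V → V} (hc : IsConeFamily K c) (x : Realization K) :
    (contraction hc (x, 1)).1 = Finsupp.single (c ∅) 1 := by
  have hpos := sum_massFlow_pos c x 1
  change ((massFlow c x.1 1).sum fun _ r => r)⁻¹ • massFlow c x.1 1 = _
  have h := massFlow_one c x.1 x.le_one
  generalize massFlow c x.1 1 = m at h hpos ⊢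
  subst h
  rw [Finsupp.sum_single_index rfl] at hpos ⊢
  rw [Finsupp.smul_single, smul_eq_mul, inv_mul_cancel₀ hpos.ne']

/-! ### Continuity of the contraction, simplex by simplex. -/

theorem continuous_extend_apply (s : Finset V) (v : V) :
    Continuous fun x : s → ℝ => extend s x v := by
  by_cases hv : v ∈ s
  · simpa only [extend_apply_mem s _ ⟨v, hv⟩] using continuous_apply (⟨v, hv⟩ : s)
  · simpa only [extend_apply_notMem s _ hv] using continuous_const

theorem continuous_outerSup_extend (s σ : Finset V) :
    Continuous fun x : s → ℝ => outerSup σ (extend s x) := by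
  classical
  simp only [outerSup_eq σ _ (support_extend_subset s _)]
  exact NNReal.continuous_coe.comp (Continuous.finset_sup_apply fun v _ =>
    continuous_real_toNNReal.comp (continuous_extend_apply s v))

theorem continuous_weight_extend (s σ : Finset V) :
    Continuous fun p : (s → ℝ) × unitInterval => weight σ (extend s p.1) p.2 := by
  have h1 := (continuous_outerSup_extend s σ).comp (continuous_fst (Y := unitInterval))
  have h2 := fun v => (continuous_extend_apply s v).comp (continuous_fst (Y := unitInterval))
  simp only [Function.comp_def] at h1 h2
  unfold weight
  refine Continuous.mul (by split_ifs <;> fun_prop) (Continuous.mul (by fun_prop) ?_)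
  exact continuous_finsetProd _ fun v _ => ((h2 v).sub h1).max continuous_const

theorem continuous_massFlow_extend (c : Finset V → V) (s : Finset V) (u : V) :
    Continuous fun p : (s → ℝ) × unitInterval => massFlow c (extend s p.1) p.2 u := by
  classical
  simp only [massFlow_apply c _ _ (support_extend_subset s _)]
  have h2 := (continuous_extend_apply s u).comp (continuous_fst (Y := unitInterval))
  simp only [Function.comp_def] at h2
  refine Continuous.add (by fun_prop) (continuous_finsetSum _ fun σ _ => ?_)
  split_ifs
  exacts [continuous_weight_extend s σ, continuous_const]

theorem support_massFlow_subset [DecidableEq V] (c : Finset V → V) (x : V →₀ ℝ) (t : unitInterval)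
    {s : Finset V} (h : x.support ⊆ s) :
    (massFlow c x t).support ⊆ s ∪ s.powerset.image c := by
  intro u hu
  by_contra h'
  rw [Finset.mem_union, not_or] at h'
  refine Finsupp.mem_support_iff.1 hu ?_
  rw [massFlow_apply c x t h, Finset.sum_eq_zero, add_zero,
    Finsupp.notMem_support_iff.1 fun h2 => h'.1 (h h2)]
  · exact max_eq_right (by linarith [t.2.1])
  · intro σ hσ
    rw [if_neg]
    rintro rfl
    exact h'.2 (Finset.mem_image_of_mem c hσ)

theorem continuous_sum_massFlow_extend (c : Finset V → V) (s : Finset V) :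
    Continuous fun p : (s → ℝ) × unitInterval =>
      (massFlow c (extend s p.1) p.2).sum fun _ r => r := by
  classical
  have : ∀ p : (s → ℝ) × unitInterval, ((massFlow c (extend s p.1) p.2).sum fun _ r => r) =
      ∑ u ∈ s ∪ s.powerset.image c, massFlow c (extend s p.1) p.2 u := fun p =>
    Finsupp.sum_of_support_subset _
      (support_massFlow_subset c _ p.2 (support_extend_subset s p.1)) _ fun _ _ => rfl
  simp only [this]
  exact continuous_finsetSum _ fun u _ => continuous_massFlow_extend c s u

theorem continuous_contraction {c : Finset V → V} (hc : IsConeFamily K c) :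
    Continuous (contraction hc) := by
  classical
  refine Realization.continuous_prod_unitInterval _ fun s hs => ?_
  have hval : Continuous fun p : stdSimplex ℝ s × unitInterval => (p.1.1, p.2) :=
    (continuous_subtype_val.comp continuous_fst).prodMk continuous_snd
  -- The image of a closed simplex need not lie in one simplex, but it involves only finitely many
  -- vertices.
  refine Realization.continuous_of_support_subset _ (s ∪ s.powerset.image c)
    (fun p => Finsupp.support_smul.trans
      (support_massFlow_subset c _ p.2 (support_extend_subset s p.1.1))) fun u => ?_
  have hsum := (continuous_sum_massFlow_extend c s).comp hval
  have hmass := (continuous_massFlow_extend c s u).comp hval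
  exact (hsum.inv₀ fun p => (sum_massFlow_pos c (simplexMap K s hs p.1) p.2).ne').mul hmass

/-- If every finite set of vertices can be coned off inside of `K`, then the realization of `K`
is contractible. -/
theorem contractibleSpace_realization (K : PreAbstractSimplicialComplex V)
    (hK : ∀ S : Finset V, ∃ v, ∀ ρ ⊆ S, ρ = ∅ ∨ ρ ∈ K.faces →
      ∃ ρ' ∈ K.faces, ρ ⊆ ρ' ∧ v ∈ ρ') : ContractibleSpace (Realization K) := by
  obtain ⟨c, hc⟩ := exists_isConeFamily K hK
  -- The endpoint `c ∅` is thus a vertex of a simplex of `K`.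
  obtain ⟨ρ, hρ, -, hmem⟩ := hc ∅ {∅} (Or.inl rfl) (by simp) (by simp) (by simp)
  let z : Realization K := ⟨Finsupp.single (c ∅) 1, by
    refine ⟨?_, fun v => ?_, Finsupp.sum_single_index rfl⟩
    · refine (K.isRelLowerSet_faces hρ).2 (show _ ⊆ ρ from ?_) (by simp)
      exact Finsupp.support_single_subset.trans (Finset.singleton_subset_iff.2 (hmem ∅ (by simp)))
    · exact Finsupp.single_nonneg.2 zero_le_one v⟩
  rw [contractible_iff_id_nullhomotopic]
  refine ⟨z, ⟨⟨⟨fun p => contraction hc (p.2, p.1),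
    (continuous_contraction hc).comp continuous_swap⟩, fun x => ?_, fun x => ?_⟩⟩⟩
  · exact contraction_zero hc x
  · exact Subtype.ext (contraction_one hc x)

end Contraction

/-! ### Cone points from common complements. -/

section Group

variable {G : Type*} [Group G]

theorem exists_cone_point_cosetNerve (F : Set (Subgroup G)) (hne : F.Nonempty)
    (hF : ∀ S : Set (Subgroup G), S ⊆ F → S.Finite → S.Nonempty →
      ∃ K ∈ F, IsCommonComplementOf K S) (S : Finset (cosets F)) :
    ∃ v, ∀ ρ ⊆ S, ρ = ∅ ∨ ρ ∈ (cosetNerve F).faces →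
      ∃ ρ' ∈ (cosetNerve F).faces, ρ ⊆ ρ' ∧ v ∈ ρ' := by
  classical
  obtain ⟨H₀, hH₀⟩ := hne
  choose H hHF g hg using fun C : cosets F => C.2
  -- Inserting `H₀` keeps the family nonempty when `S` is empty.
  obtain ⟨K, hKF, -, hK⟩ := hF (insert H₀ (H '' (S : Set (cosets F))))
    (Set.insert_subset hH₀ (Set.image_subset_iff.2 fun C _ => hHF C))
    ((S.finite_toSet.image H).insert H₀) (Set.insert_nonempty _ _)
  refine ⟨⟨K, K, hKF, 1, (one_smul _ _).symm⟩, fun ρ hρ hface => ⟨insert _ ρ, ⟨by simp, ?_⟩,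
    Finset.subset_insert _ _, Finset.mem_insert_self _ _⟩⟩
  obtain ⟨x, hx⟩ : ∃ x : G, ∀ C ∈ ρ, x ∈ (C : Set G) := by
    rcases hface with rfl | ⟨-, x, hx⟩
    · exact ⟨1, by simp⟩
    · exact ⟨x, fun C hC => Set.mem_iInter₂.1 hx C hC⟩
  -- From `x⁻¹ = h * k`, the element `x * h = k⁻¹` lies in `K`, and also in every coset of `ρ`, as
  -- `h` lies in all their subgroups.
  obtain ⟨h, hh, k, hk, hhk⟩ := Set.mem_mul.1 (hK ▸ Set.mem_univ x⁻¹)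
  refine ⟨x * h, Set.mem_iInter₂.2 fun C hC => ?_⟩
  rcases Finset.mem_insert.1 hC with rfl | hC
  · have : x * h = k⁻¹ := by
      rw [← inv_inj, mul_inv_rev, ← hhk]
      group
    exact this ▸ K.inv_mem hk
  · have h1 := hx C hC
    have h2 : h ∈ H C := Subgroup.mem_sInf.1 hh _
      (Set.mem_insert_of_mem _ (Set.mem_image_of_mem H (hρ hC)))
    change x * h ∈ (C : Set G)
    rw [hg C, Set.mem_smul_set_iff_inv_smul_mem, smul_eq_mul] at h1 ⊢
    rw [← mul_assoc]
    exact (H C).mul_mem h1 h2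

end Group

end CosetNerve

theorem proposition1p2 {G : Type*} [Group G] (F : Set (Subgroup G)) (hne : F.Nonempty)
    (hF : ∀ S : Set (Subgroup G), S ⊆ F → S.Finite → S.Nonempty →
      ∃ K ∈ F, CosetNerve.IsCommonComplementOf K S) :
    ContractibleSpace (CosetNerve.Realization (CosetNerve.cosetNerve F)) :=
  CosetNerve.contractibleSpace_realization _
    (CosetNerve.exists_cone_point_cosetNerve F hne hF)
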